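/- Consider rational data $c\in\mathbb Q^{n_x}$, $d,f\in\mathbb Q^{n_y}$, $G\in\mathbb Q^{k\times n_x}$, $g\in\mathbb Q^{k}$, $C\in\mathbb Q^{l\times n_x}$, $D\in\mathbb Q^{l\times n_y}$, $b\in\mathbb Q^{l}$, and let $X=\{x\in\mathbb R^{n_x}: Gx\ge g\}$. For $x\in X$ let $S(x)$ be the set of optimal solutions of $\min_y\{f^\top y: Cx+Dy\ge b\}$. Assume that (i) for every $x\in X$ the set $\{y\in\mathbb R^{n_y}: Cx+Dy\ge b\}$ is non-empty and compact, (ii) $X$ is non-empty, and (iii) the function $x\mapsto c^\top x+\min_y\{d^\top y: y\in S(x)\}$ is bounded from below on $X$. Let $\tilde X=\{(x,\bar y): x\in X,\ D\bar y\ge b-Cx\}$ and, for $(x,\bar y)\in\tilde X$, let $\tilde S(x,\bar y)$ be the set of optimal solutions $(y,\varepsilon)\in\mathbb R^{n_y}\times\mathbb R$ of $$\min_{y,\varepsilon}\ f^\top y\quad\text{s.t.}\quad Cx+Dy\ge b,\quad f^\top\bar y-f^\top y=\varepsilon,\quad \varepsilon\ge 0 .$$ Then there is a rational $\kappa>0$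 of polynomial size (that is, the bit-encoding length of $\kappa$ is bounded by a fixed polynomial, independent of the instance, in the bit-encoding length of the data $c,d,f,G,g,C,D,b$) such that the optimistic bilevel problem with the single coupling constraint $\varepsilon=0$, $$\min_{(x,\bar y)\in\tilde X}\ c^\top x+d^\top\bar y+\min_{y,\varepsilon}\{0:\ \varepsilon=0,\ (y,\varepsilon)\in\tilde S(x,\bar y)\},$$ and the optimistic bilevel problem without coupling constraints $$\min_{(x,\bar y)\in\tilde X}\ c^\top x+d^\top\bar y+\min_{y,\varepsilon}\{\kappa\varepsilon:\ (y,\varepsilon)\in\tilde S(x,\bar y)\}$$ have the same set of globally optimal solutions $(x,\bar y)$. Here a minimum over the empty set is $+\infty$. -/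

import Mathlib

open Matrix

/-- Bit length of a rational `p / q` in lowest terms: a sign bit plus the binary lengths of
`|p|` and `q`. -/
def ratSize (r : ℚ) : ℕ := 1 + Nat.size r.num.natAbs + Nat.size r.den

/-- Bit length of a rational vector: its dimension plus the bit lengths of its entries. -/
def vecSize {n : ℕ} (v : Fin n → ℚ) : ℕ := n + ∑ i, ratSize (v i)

/-- Bit length of a rational matrix: the number of entries plus their bit lengths. -/
def matSize {m n : ℕ} (A : Matrix (Fin m) (Fin n) ℚ) : ℕ := m * n + ∑ i, ∑ j, ratSize (A i j)

/-- A rational vector, read as a real vector. -/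
def realVec {n : ℕ} (v : Fin n → ℚ) : Fin n → ℝ := fun i => (v i : ℝ)

/-- A rational matrix, read as a real matrix. -/
def realMat {m n : ℕ} (A : Matrix (Fin m) (Fin n) ℚ) : Matrix (Fin m) (Fin n) ℝ :=
  A.map (fun q : ℚ => (q : ℝ))

/-- The rational data of a linear bilevel problem with `nx` leader variables, `ny` follower
variables, `k` leader constraints `G x ≥ g` and `l` follower constraints `C x + D y ≥ b`. -/
structure BilevelData (nx ny k l : ℕ) where
  c : Fin nx → ℚ
  d : Fin ny → ℚ
  f : Fin ny → ℚ
  G : Matrix (Fin k) (Fin nx) ℚ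
  g : Fin k → ℚ
  C : Matrix (Fin l) (Fin nx) ℚ
  D : Matrix (Fin l) (Fin ny) ℚ
  b : Fin l → ℚ

namespace BilevelData

variable {nx ny k l : ℕ}

/-- The bit-encoding length of the data. -/
def encodingLength (P : BilevelData nx ny k l) : ℕ :=
  vecSize P.c + vecSize P.d + vecSize P.f + matSize P.G + vecSize P.g +
    matSize P.C + matSize P.D + vecSize P.b

/-- The polyhedron `X = {x | G x ≥ g}` of the leader. -/
def leaderSet (P : BilevelData nx ny k l) : Set (Fin nx → ℝ) :=
  {x | realVec P.g ≤ realMat P.G *ᵥ x}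

/-- The follower's feasible set `{y | C x + D y ≥ b}`. -/
def followerFeasible (P : BilevelData nx ny k l) (x : Fin nx → ℝ) : Set (Fin ny → ℝ) :=
  {y | realVec P.b ≤ realMat P.C *ᵥ x + realMat P.D *ᵥ y}

/-- `S(x)`: the minimizers of `fᵀ y` over the follower's feasible set. -/
def followerOpt (P : BilevelData nx ny k l) (x : Fin nx → ℝ) : Set (Fin ny → ℝ) :=
  {y | y ∈ P.followerFeasible x ∧
    IsMinOn (fun y' : Fin ny → ℝ => realVec P.f ⬝ᵥ y') (P.followerFeasible x) y}

/-- `F_o(x) = cᵀ x + min {dᵀ y | y ∈ S(x)}`, with value `+∞` if `S(x)` is empty. -/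
noncomputable def optimisticObj (P : BilevelData nx ny k l) (x : Fin nx → ℝ) : EReal :=
  ((realVec P.c ⬝ᵥ x : ℝ) : EReal) +
    ⨅ y ∈ P.followerOpt x, ((realVec P.d ⬝ᵥ y : ℝ) : EReal)

/-- The standing assumptions: `X` is non-empty, the follower's feasible set is non-empty and
compact for every `x ∈ X`, and the leader's objective function is bounded from below on `X`. -/
structure StandingAssumptions (P : BilevelData nx ny k l) : Prop where
  leaderSet_nonempty : P.leaderSet.Nonempty
  follower_nonempty : ∀ x ∈ P.leaderSet, (P.followerFeasible x).Nonempty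
  follower_compact : ∀ x ∈ P.leaderSet, IsCompact (P.followerFeasible x)
  obj_bddBelow : ∃ M : ℝ, ∀ x ∈ P.leaderSet, (M : EReal) ≤ P.optimisticObj x

/-- `X̃ = {(x, ȳ) | x ∈ X, D ȳ ≥ b - C x}`. -/
def auxLeaderSet (P : BilevelData nx ny k l) : Set ((Fin nx → ℝ) × (Fin ny → ℝ)) :=
  {p | p.1 ∈ P.leaderSet ∧ realVec P.b - realMat P.C *ᵥ p.1 ≤ realMat P.D *ᵥ p.2}

/-- Pairs `(y, ε)` with `C x + D y ≥ b`, `fᵀ ȳ - fᵀ y = ε` and `ε ≥ 0`, where `p = (x, ȳ)`. -/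
def auxFollowerFeasible (P : BilevelData nx ny k l) (p : (Fin nx → ℝ) × (Fin ny → ℝ)) :
    Set ((Fin ny → ℝ) × ℝ) :=
  {z | realVec P.b ≤ realMat P.C *ᵥ p.1 + realMat P.D *ᵥ z.1 ∧
    realVec P.f ⬝ᵥ p.2 - realVec P.f ⬝ᵥ z.1 = z.2 ∧ 0 ≤ z.2}

/-- `S̃(x, ȳ)`: the pairs `(y, ε)` that minimize `fᵀ y` over the set above. -/
def auxFollowerOpt (P : BilevelData nx ny k l) (p : (Fin nx → ℝ) × (Fin ny → ℝ)) :
    Set ((Fin ny → ℝ) × ℝ) :=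
  {z | z ∈ P.auxFollowerFeasible p ∧
    IsMinOn (fun z' : (Fin ny → ℝ) × ℝ => realVec P.f ⬝ᵥ z'.1) (P.auxFollowerFeasible p) z}

/-- `F_oa(x, ȳ) = cᵀ x + dᵀ ȳ + min {0 | ε = 0, (y, ε) ∈ S̃(x, ȳ)}`; it is `+∞` if no such
`(y, ε)` exists. -/
noncomputable def coupledObj (P : BilevelData nx ny k l)
    (p : (Fin nx → ℝ) × (Fin ny → ℝ)) : EReal :=
  ((realVec P.c ⬝ᵥ p.1 + realVec P.d ⬝ᵥ p.2 : ℝ) : EReal) +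
    ⨅ z ∈ {z : (Fin ny → ℝ) × ℝ | z.2 = 0 ∧ z ∈ P.auxFollowerOpt p}, (0 : EReal)

/-- `F_oκ(x, ȳ) = cᵀ x + dᵀ ȳ + min {κ ε | (y, ε) ∈ S̃(x, ȳ)}`. -/
noncomputable def penalizedObj (P : BilevelData nx ny k l) (κ : ℝ)
    (p : (Fin nx → ℝ) × (Fin ny → ℝ)) : EReal :=
  ((realVec P.c ⬝ᵥ p.1 + realVec P.d ⬝ᵥ p.2 : ℝ) : EReal) +
    ⨅ z ∈ P.auxFollowerOpt p, ((κ * z.2 : ℝ) : EReal)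

end BilevelData

/-- The globally optimal solutions of `min_{p ∈ K} F p`: points of `K` with `F p < +∞` at which
`F` attains its minimum over `K`. -/
def globalOptimizers {α : Type*} (K : Set α) (F : α → EReal) : Set α :=
  {p | p ∈ K ∧ F p < ⊤ ∧ IsMinOn F K p}

/-!
If `S(x)` is empty, both objectives are `+∞` at `(x, ȳ)`. Otherwise let `v` be the optimal value of
the follower at `x` and `gap = fᵀ ȳ - v`. Then `S̃(x, ȳ)` consists of the pairs `(y, gap)` with
`y ∈ S(x)`, so the penalized objective at `(x, ȳ)` is `cᵀ x + dᵀ ȳ + κ gap`, and the coupled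
objective is `cᵀ x + dᵀ ȳ` if `gap = 0` and `+∞` otherwise. The penalty is exact as soon as
`gap > 0` implies that some `y ∈ S(x)` has `dᵀ y < dᵀ ȳ + κ gap`.

Now `S(x)` is the polyhedron `D y ≥ b - C x`, `-fᵀ y ≥ -v`, and `ȳ` violates only the last
inequality, by `gap`. If every `y ∈ S(x)` had `dᵀ y ≥ dᵀ ȳ + κ gap`, then Farkas' lemma and
Carathéodory's theorem for cones would give a basic dual solution that proves `κ gap ≤ μ gap`, where
`μ` is its multiplier for the row `-f`. A basic dual solution is determined by a linear system in
`D`, `f` and `d` alone, so Cramer's rule bounds `μ` by `2 ^ (6 L ^ 2)` uniformly in `x`, where `L`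
is the encoding length.
-/

section LinearProgramming

theorem dual_eq_smul_of_eq_zero_on_ker {𝕜 V : Type*} [Field 𝕜] [AddCommGroup V] [Module 𝕜 V]
    {φ χ : Module.Dual 𝕜 V} (hker : ∀ v, φ v = 0 → χ v = 0) {v₀ : V} (hv₀ : φ v₀ ≠ 0) :
    χ = (χ v₀ / φ v₀) • φ := by
  ext v
  have hv : χ (v - (φ v / φ v₀) • v₀) = 0 := hker _ (by simp [hv₀])
  rw [map_sub, map_smul, smul_eq_mul, sub_eq_zero] at hv
  rw [LinearMap.smul_apply, smul_eq_mul, hv]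
  ring

theorem exists_nonneg_sum_smul_insert_eq {R V ι : Type*} [Semiring R] [Preorder R]
    [AddCommMonoid V] [Module R V] [DecidableEq ι] {a : ι} {s : Finset ι} (ha : a ∉ s) (x : ι → V)
    {c : R} (hc : 0 ≤ c) {μ : ι → R} (hμ : ∀ i ∈ s, 0 ≤ μ i) :
    ∃ ν : ι → R, (∀ i ∈ insert a s, 0 ≤ ν i) ∧
      ∑ i ∈ insert a s, ν i • x i = c • x a + ∑ i ∈ s, μ i • x i := by
  have hupdate : ∀ i ∈ s, Function.update μ a c i = μ i := fun i hi =>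
    Function.update_of_ne (ne_of_mem_of_not_mem hi ha) _ _
  refine ⟨Function.update μ a c, (Finset.forall_mem_insert _ _ _).2
    ⟨by rwa [Function.update_self], fun i hi => (hμ i hi).trans_eq (hupdate i hi).symm⟩, ?_⟩
  rw [Finset.sum_insert ha, Function.update_self]
  exact congrArg (c • x a + ·) (Finset.sum_congr rfl fun i hi => by rw [hupdate i hi])

/-- A basic feasible solution of the dual of a linear program with objective `d` and constraint
functionals `φ i`, supported on `t`. -/
structure IsBasicDualSolution {R V ι : Type*} [Semiring R] [Preorder R] [AddCommMonoid V]
    [Module R V] (φ : ι → V) (d : V) (t : Finset ι) (μ : ι → R) : Prop where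
  nonneg : ∀ i ∈ t, 0 ≤ μ i
  linearIndepOn : LinearIndepOn R φ (t : Set ι)
  sum_smul_eq : ∑ i ∈ t, μ i • φ i = d

theorem IsBasicDualSolution.of_map {R V W ι : Type*} [Semiring R] [Preorder R]
    [AddCommMonoid V] [Module R V] [AddCommMonoid W] [Module R W] {f : V →ₗ[R] W}
    (hf : Function.Injective f) {φ : ι → V} {d : V} {t : Finset ι} {μ : ι → R}
    (h : IsBasicDualSolution (fun i => f (φ i)) (f d) t μ) : IsBasicDualSolution φ d t μ where
  nonneg := h.nonneg
  linearIndepOn := LinearIndependent.of_comp f h.linearIndepOn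
  sum_smul_eq := hf (by simpa only [map_sum, map_smul] using h.sum_smul_eq)

variable {𝕜 V ι : Type*} [Field 𝕜] [LinearOrder 𝕜] [IsStrictOrderedRing 𝕜]
  [AddCommGroup V] [Module 𝕜 V]

theorem exists_nonneg_sum_smul_eq_of_forall_nonneg (s : Finset ι) (φ : ι → Module.Dual 𝕜 V)
    (ψ : Module.Dual 𝕜 V) (h : ∀ v, (∀ i ∈ s, 0 ≤ φ i v) → 0 ≤ ψ v) :
    ∃ μ : ι → 𝕜, (∀ i ∈ s, 0 ≤ μ i) ∧ ∑ i ∈ s, μ i • φ i = ψ := by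
  classical
  induction s using Finset.induction_on generalizing V with
  | empty =>
    refine ⟨0, by simp, LinearMap.ext fun v => ?_⟩
    have hneg := h (-v) (by simp)
    rw [map_neg, neg_nonneg] at hneg
    simpa using (h v (by simp)).antisymm hneg
  | insert a s ha ih =>
    suffices ∃ c : 𝕜, 0 ≤ c ∧ ∃ μ : ι → 𝕜, (∀ i ∈ s, 0 ≤ μ i) ∧
        c • φ a + ∑ i ∈ s, μ i • φ i = ψ by
      obtain ⟨c, hc, μ, hμ, rfl⟩ := this
      exact exists_nonneg_sum_smul_insert_eq ha φ hc hμ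
    by_cases hs : ∀ v, (∀ i ∈ s, 0 ≤ φ i v) → 0 ≤ ψ v
    · obtain ⟨μ, hμ, hψ⟩ := ih φ ψ hs
      exact ⟨0, le_rfl, μ, hμ, by rw [zero_smul, zero_add, hψ]⟩
    push Not at hs
    obtain ⟨v₀, hv₀, hψv₀⟩ := hs
    have hav₀ : φ a v₀ < 0 := by
      by_contra! hc
      exact hψv₀.not_ge (h v₀ ((Finset.forall_mem_insert _ _ _).2 ⟨hc, hv₀⟩))
    -- On the kernel of `φ a` the functional `ψ` is controlled by the remaining ones alone.
    let W := LinearMap.ker (φ a)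
    obtain ⟨μ, hμ, hψ⟩ := ih (fun i => φ i ∘ₗ W.subtype) (ψ ∘ₗ W.subtype) fun w hw =>
      h w ((Finset.forall_mem_insert _ _ _).2 ⟨(LinearMap.mem_ker.1 w.2).ge, hw⟩)
    set χ := ψ - ∑ i ∈ s, μ i • φ i with hχ
    have hχker : ∀ w, φ a w = 0 → χ w = 0 := fun w hw => by
      simpa [hχ, sub_eq_zero] using (LinearMap.congr_fun hψ ⟨w, hw⟩).symm
    have hχv₀ : χ v₀ ≤ 0 := by
      have := Finset.sum_nonneg fun i hi => mul_nonneg (hμ i hi) (hv₀ i hi)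
      simp only [hχ, LinearMap.sub_apply, LinearMap.sum_apply, LinearMap.smul_apply, smul_eq_mul]
      linarith
    refine ⟨χ v₀ / φ a v₀, div_nonneg_of_nonpos hχv₀ hav₀.le, μ, hμ, ?_⟩
    rw [← dual_eq_smul_of_eq_zero_on_ker hχker hav₀.ne, hχ, sub_add_cancel]

theorem nonneg_of_forall_le_of_recession {φ : ι → Module.Dual 𝕜 V} {r : ι → 𝕜}
    {d : Module.Dual 𝕜 V} {β : 𝕜} {y₀ : V} (hy₀ : ∀ i, r i ≤ φ i y₀)
    (hβ : ∀ y, (∀ i, r i ≤ φ i y) → β ≤ d y) {v : V} (hv : ∀ i, 0 ≤ φ i v) : 0 ≤ d v := by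
  by_contra! hdv
  let lam := (d y₀ - β + 1) / -d v
  have hlam : 0 ≤ lam := div_nonneg (by linarith [hβ y₀ hy₀]) (by linarith)
  have hle : β ≤ d (y₀ + lam • v) := hβ _ fun i => by
    rw [map_add, map_smul, smul_eq_mul]
    linarith [hy₀ i, mul_nonneg hlam (hv i)]
  have hval : lam * d v = -(d y₀ - β + 1) := by
    simp only [lam]
    field_simp [hdv.ne]
  rw [map_add, map_smul, smul_eq_mul, hval] at hle
  linarith

theorem exists_nonneg_sum_smul_eq_of_forall_le [Fintype ι] (φ : ι → Module.Dual 𝕜 V) (r : ι → 𝕜)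
    (d : Module.Dual 𝕜 V) {β : 𝕜} {y₀ : V} (hy₀ : ∀ i, r i ≤ φ i y₀)
    (hβ : ∀ y, (∀ i, r i ≤ φ i y) → β ≤ d y) :
    ∃ μ : ι → 𝕜, (∀ i, 0 ≤ μ i) ∧ ∑ i, μ i • φ i = d ∧ β ≤ ∑ i, μ i * r i := by
  -- Homogenize: on `V × 𝕜`, `d v - β τ` is nonnegative wherever `τ` and all `φ i v - r i τ` are.
  let Φ : Option ι → Module.Dual 𝕜 (V × 𝕜)
    | none => LinearMap.snd 𝕜 V 𝕜
    | some i => φ i ∘ₗ LinearMap.fst 𝕜 V 𝕜 - r i • LinearMap.snd 𝕜 V 𝕜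
  have hnonneg : ∀ p, (∀ o ∈ Finset.univ, 0 ≤ Φ o p) →
      0 ≤ (d ∘ₗ LinearMap.fst 𝕜 V 𝕜 - β • LinearMap.snd 𝕜 V 𝕜) p := by
    rintro ⟨v, τ⟩ h
    simp only [Finset.mem_univ, true_imp_iff, Option.forall] at h
    obtain ⟨hτ, hφ⟩ : 0 ≤ τ ∧ ∀ i, r i * τ ≤ φ i v := by simpa [Φ] using h
    suffices β * τ ≤ d v by simpa using this
    rcases hτ.eq_or_lt with rfl | hτ
    · simpa using nonneg_of_forall_le_of_recession hy₀ hβ fun i => by simpa using hφ i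
    · have hle := hβ (τ⁻¹ • v) fun i => by
        rw [map_smul, smul_eq_mul, le_inv_mul_iff₀' hτ]
        exact hφ i
      rwa [map_smul, smul_eq_mul, le_inv_mul_iff₀' hτ] at hle
  obtain ⟨μ, hμ, hsum⟩ := exists_nonneg_sum_smul_eq_of_forall_nonneg Finset.univ Φ _ hnonneg
  rw [Fintype.sum_option] at hsum
  refine ⟨fun i => μ (some i), fun i => hμ _ (Finset.mem_univ _), LinearMap.ext fun v => ?_, ?_⟩
  · simpa [Φ] using LinearMap.congr_fun hsum (v, 0)
  · have hβ' : μ none - ∑ i, μ (some i) * r i = -β := by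
      simpa [Φ, sub_eq_add_neg] using LinearMap.congr_fun hsum (0, 1)
    linarith [hμ none (Finset.mem_univ _)]

theorem exists_dependency_pos_of_not_linearIndepOn {a : ι → V} {s : Finset ι}
    (hs : ¬LinearIndepOn 𝕜 a (s : Set ι)) {w : ι → 𝕜} (hw : ∀ i ∈ s, 0 ≤ w i) :
    ∃ g : ι → 𝕜, ∑ i ∈ s, g i • a i = 0 ∧ 0 ≤ ∑ i ∈ s, g i * w i ∧ ∃ i ∈ s, 0 < g i := by
  rw [linearIndepOn_finset_iff] at hs
  push Not at hs
  obtain ⟨g, hg, i, hi, hgi⟩ := hs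
  wlog hgw : 0 ≤ ∑ i ∈ s, g i * w i generalizing g
  · refine this (-g) (by simp [hg]) (by simpa using hgi) ?_
    simpa using (not_le.1 hgw).le
  by_cases! hpos : ∃ i ∈ s, 0 < g i
  · exact ⟨g, hg, hgw, hpos⟩
  · refine ⟨-g, by simp [hg], ?_, i, hi, by simpa using (hpos i hi).lt_of_ne hgi⟩
    exact Finset.sum_nonneg fun j hj => mul_nonneg (neg_nonneg.2 (hpos j hj)) (hw j hj)

theorem exists_ratio_mul_le {s : Finset ι} {μ g : ι → 𝕜} (hμ : ∀ i ∈ s, 0 ≤ μ i)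
    (hg : ∃ i ∈ s, 0 < g i) :
    ∃ τ ≥ 0, (∀ i ∈ s, τ * g i ≤ μ i) ∧ ∃ i ∈ s, τ * g i = μ i := by
  obtain ⟨i₁, hi₁, hgi₁⟩ := hg
  obtain ⟨i₀, hi₀, hmin⟩ := (s.filter fun i => 0 < g i).exists_min_image (fun i => μ i / g i)
    ⟨i₁, Finset.mem_filter.2 ⟨hi₁, hgi₁⟩⟩
  obtain ⟨hi₀s, hgi₀⟩ := Finset.mem_filter.1 hi₀
  have hτ : 0 ≤ μ i₀ / g i₀ := div_nonneg (hμ _ hi₀s) hgi₀.le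
  refine ⟨μ i₀ / g i₀, hτ, fun i hi => ?_, i₀, hi₀s, div_mul_cancel₀ _ hgi₀.ne'⟩
  rcases lt_or_ge 0 (g i) with hgi | hgi
  · exact (le_div_iff₀ hgi).1 (hmin i (Finset.mem_filter.2 ⟨hi, hgi⟩))
  · exact (mul_nonpos_of_nonneg_of_nonpos hτ hgi).trans (hμ i hi)

theorem exists_linearIndepOn_conic_combination_of_le (a : ι → V) (s : Finset ι) (μ w : ι → 𝕜)
    (hμ : ∀ i ∈ s, 0 ≤ μ i) (hw : ∀ i ∈ s, 0 ≤ w i) :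
    ∃ t ⊆ s, ∃ ν : ι → 𝕜, (∀ i ∈ t, 0 ≤ ν i) ∧ LinearIndepOn 𝕜 a (t : Set ι) ∧
      ∑ i ∈ t, ν i • a i = ∑ i ∈ s, μ i • a i ∧ ∑ i ∈ t, ν i * w i ≤ ∑ i ∈ s, μ i * w i := by
  classical
  induction s using Finset.strongInduction generalizing μ with
  | H s ih =>
    by_cases hs : LinearIndepOn 𝕜 a (s : Set ι)
    · exact ⟨s, subset_rfl, μ, hμ, hs, rfl, le_rfl⟩
    obtain ⟨g, hg, hgw, hpos⟩ := exists_dependency_pos_of_not_linearIndepOn hs hw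
    obtain ⟨τ, hτ, hle, i₀, hi₀, heq⟩ := exists_ratio_mul_le hμ hpos
    obtain ⟨t, hts, ν, hν, hli, hsum, hcost⟩ := ih (s.erase i₀) (Finset.erase_ssubset hi₀)
      (fun i => μ i - τ * g i) (fun i hi => sub_nonneg.2 (hle i (Finset.mem_of_mem_erase hi)))
      fun i hi => hw i (Finset.mem_of_mem_erase hi)
    refine ⟨t, hts.trans (Finset.erase_subset _ _), ν, hν, hli, hsum.trans ?_, hcost.trans ?_⟩
    · rw [Finset.sum_erase s (by rw [heq, sub_self, zero_smul])]
      simp only [sub_smul, mul_smul, Finset.sum_sub_distrib, ← Finset.smul_sum, hg, smul_zero,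
        sub_zero]
    · rw [Finset.sum_erase s (by rw [heq, sub_self, zero_mul])]
      simp only [sub_mul, mul_assoc, Finset.sum_sub_distrib, ← Finset.mul_sum]
      exact sub_le_self _ (mul_nonneg hτ hgw)

theorem exists_isBasicDualSolution_of_forall_le [Finite ι] (φ : ι → Module.Dual 𝕜 V) (r : ι → 𝕜)
    (d : Module.Dual 𝕜 V) {β : 𝕜} {y₀ : V} (hy₀ : ∀ i, r i ≤ φ i y₀)
    (hβ : ∀ y, (∀ i, r i ≤ φ i y) → β ≤ d y) :
    ∃ t μ, IsBasicDualSolution φ d t μ ∧ β ≤ ∑ i ∈ t, μ i * r i := by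
  cases nonempty_fintype ι
  obtain ⟨μ, hμ, hd, hβμ⟩ := exists_nonneg_sum_smul_eq_of_forall_le φ r d hy₀ hβ
  -- Minimizing the slack at `y₀` amounts to maximizing `∑ μ i * r i`, as `∑ μ i * φ i y₀ = d y₀`.
  obtain ⟨t, -, ν, hν, hli, hsum, hslack⟩ := exists_linearIndepOn_conic_combination_of_le φ
    Finset.univ μ (fun i => φ i y₀ - r i) (fun i _ => hμ i) fun i _ => sub_nonneg.2 (hy₀ i)
  refine ⟨t, ν, ⟨hν, hli, hsum.trans hd⟩, ?_⟩
  have heval := LinearMap.congr_fun hsum y₀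
  simp only [LinearMap.sum_apply, LinearMap.smul_apply, smul_eq_mul] at heval
  simp only [mul_sub, Finset.sum_sub_distrib, heval] at hslack
  linarith

theorem le_add_mul_violation [Finite ι] {φ : ι → Module.Dual 𝕜 V} {r : ι → 𝕜}
    {d : Module.Dual 𝕜 V} {o : ι} {M : 𝕜} (hM₀ : 0 ≤ M)
    (hM : ∀ t μ, IsBasicDualSolution φ d t μ → o ∈ t → μ o ≤ M)
    {β : 𝕜} {y₀ : V} (hy₀ : ∀ i, r i ≤ φ i y₀) (hβ : ∀ y, (∀ i, r i ≤ φ i y) → β ≤ d y)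
    {z : V} (hz : ∀ i ≠ o, r i ≤ φ i z) (hzo : φ o z ≤ r o) :
    β ≤ d z + M * (r o - φ o z) := by
  classical
  obtain ⟨t, μ, hμ, hβμ⟩ := exists_isBasicDualSolution_of_forall_le φ r d hy₀ hβ
  have hterm : ∀ i ∈ t,
      μ i * (r i - φ i z) ≤ if o = i then M * (r o - φ o z) else 0 := by
    intro i hi
    split_ifs with hio
    · subst hio
      exact mul_le_mul_of_nonneg_right (hM t μ hμ hi) (sub_nonneg.2 hzo)
    · exact mul_nonpos_of_nonneg_of_nonpos (hμ.nonneg i hi) (sub_nonpos.2 (hz i (Ne.symm hio)))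
  have hdz : ∑ i ∈ t, μ i * φ i z = d z := by
    simpa using LinearMap.congr_fun hμ.sum_smul_eq z
  calc β ≤ d z + ∑ i ∈ t, μ i * (r i - φ i z) := by
        simpa only [mul_sub, Finset.sum_sub_distrib, hdz, add_sub_cancel] using hβμ
    _ ≤ d z + ∑ i ∈ t, if o = i then M * (r o - φ o z) else 0 := by
        gcongr with i hi
        exact hterm i hi
    _ ≤ d z + M * (r o - φ o z) := by
        rw [Finset.sum_ite_eq]
        have := mul_nonneg hM₀ (sub_nonneg.2 hzo)
        split_ifs <;> linarith

end LinearProgramming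

section IntegralSystems

theorem cramer_mulVec {R n : Type*} [CommRing R] [Fintype n] [DecidableEq n] (A : Matrix n n R)
    (v : n → R) : A.cramer (A *ᵥ v) = A.det • v := by
  rw [cramer_eq_adjugate_mulVec, mulVec_mulVec, adjugate_mul, smul_mulVec, one_mulVec]

theorem abs_cramer_le {R n : Type*} [CommRing R] [LinearOrder R] [IsStrictOrderedRing R]
    [Fintype n] [DecidableEq n] {A : Matrix n n R} {v : n → R} {B : R}
    (hA : ∀ i j, |A i j| ≤ B) (hv : ∀ i, |v i| ≤ B) (j : n) :
    |A.cramer v j| ≤ (Fintype.card n).factorial * B ^ Fintype.card n := by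
  rw [cramer_apply, ← nsmul_eq_mul]
  refine det_le (abv := AbsoluteValue.abs) fun i k => ?_
  rw [AbsoluteValue.abs_apply, updateCol_apply]
  split_ifs
  exacts [hv i, hA i k]

theorem abs_dotProduct_le {R n : Type*} [Ring R] [LinearOrder R] [IsStrictOrderedRing R]
    [Fintype n] {u v : n → R} {B : R} (hu : ∀ i, |u i| ≤ B) (hv : ∀ i, |v i| ≤ B) :
    |u ⬝ᵥ v| ≤ Fintype.card n * B ^ 2 :=
  calc |u ⬝ᵥ v| ≤ ∑ i, |u i * v i| := Finset.abs_sum_le_sum_abs _ _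
    _ ≤ ∑ _i : n, B ^ 2 := Finset.sum_le_sum fun i _ => by
        rw [abs_mul, sq]
        exact mul_le_mul (hu i) (hv i) (abs_nonneg _) ((abs_nonneg _).trans (hu i))
    _ = Fintype.card n * B ^ 2 := by simp

variable {𝕜 m n : Type*} [Field 𝕜] [LinearOrder 𝕜] [IsStrictOrderedRing 𝕜] [Fintype m] [Fintype n]

theorem abs_le_of_int_mulVec_eq [DecidableEq n] {A : Matrix n n ℤ} (hA : A.det ≠ 0) {w : n → ℤ}
    {μ : n → 𝕜} (h : A.map (Int.cast : ℤ → 𝕜) *ᵥ μ = fun i => (w i : 𝕜)) {B : ℤ}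
    (hAB : ∀ i j, |A i j| ≤ B) (hwB : ∀ i, |w i| ≤ B) (j : n) :
    |μ j| ≤ (Fintype.card n).factorial * (B : 𝕜) ^ Fintype.card n := by
  have hdet : (1 : 𝕜) ≤ |(A.map (Int.cast : ℤ → 𝕜)).det| := by
    rw [← Int.cast_det]
    exact_mod_cast Int.one_le_abs hA
  calc |μ j| ≤ |(A.map (Int.cast : ℤ → 𝕜)).det| * |μ j| :=
        le_mul_of_one_le_left (abs_nonneg _) hdet
    _ = |(A.map (Int.cast : ℤ → 𝕜)).cramer (fun i => (w i : 𝕜)) j| := by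
        rw [← h, cramer_mulVec, Pi.smul_apply, smul_eq_mul, abs_mul]
    _ ≤ _ := abs_cramer_le (fun i k => by rw [map_apply]; exact_mod_cast hAB i k)
        (fun i => by exact_mod_cast hwB i) j

theorem det_transpose_mul_self_ne_zero [DecidableEq n] {A : Matrix m n 𝕜}
    (hA : Function.Injective A.mulVec) : (Aᵀ * A).det ≠ 0 := by
  have hker : LinearMap.ker (Aᵀ * A).mulVecLin = ⊥ := by
    rw [ker_mulVecLin_transpose_mul_self]
    exact LinearMap.ker_eq_bot.2 hA
  rw [← isUnit_iff_ne_zero, ← isUnit_iff_isUnit_det, ← mulVec_injective_iff_isUnit]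
  exact LinearMap.ker_eq_bot.1 hker

theorem abs_le_of_int_mulVec_eq_of_injective {A : Matrix m n ℤ}
    (hA : Function.Injective (A.map (Int.cast : ℤ → 𝕜)).mulVec) {w : m → ℤ} {μ : n → 𝕜}
    (h : A.map (Int.cast : ℤ → 𝕜) *ᵥ μ = fun i => (w i : 𝕜)) {B : ℤ}
    (hAB : ∀ i j, |A i j| ≤ B) (hwB : ∀ i, |w i| ≤ B) (j : n) :
    |μ j| ≤ (Fintype.card n).factorial * (Fintype.card m * (B : 𝕜) ^ 2) ^ Fintype.card n := by
  classical
  have hgram : (Aᵀ * A).map (Int.cast : ℤ → 𝕜) =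
      (A.map (Int.cast : ℤ → 𝕜))ᵀ * A.map (Int.cast : ℤ → 𝕜) := by
    rw [← transpose_map]
    exact Matrix.map_mul (f := Int.castRingHom 𝕜)
  have hdet : (Aᵀ * A).det ≠ 0 := fun h0 => by
    apply det_transpose_mul_self_ne_zero hA
    rw [← hgram, ← Int.cast_det, h0, Int.cast_zero]
  have hnormal : (Aᵀ * A).map (Int.cast : ℤ → 𝕜) *ᵥ μ = fun i => ((Aᵀ *ᵥ w) i : 𝕜) := by
    rw [hgram, ← mulVec_mulVec, h]
    ext i
    simp [mulVec, dotProduct]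
  have hbound := abs_le_of_int_mulVec_eq hdet hnormal (B := Fintype.card m * B ^ 2)
    (fun i k => abs_dotProduct_le (fun i' => hAB i' i) fun i' => hAB i' k)
    (fun i => abs_dotProduct_le (fun i' => hAB i' i) hwB) j
  exact_mod_cast hbound

end IntegralSystems

section RationalSystems

theorem den_le_two_pow_ratSize (q : ℚ) : q.den ≤ 2 ^ ratSize q :=
  (Nat.lt_size_self _).le.trans (Nat.pow_le_pow_right two_pos (by unfold ratSize; omega))

theorem natAbs_num_le_two_pow_ratSize (q : ℚ) : q.num.natAbs ≤ 2 ^ ratSize q :=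
  (Nat.lt_size_self _).le.trans (Nat.pow_le_pow_right two_pos (by unfold ratSize; omega))

theorem one_le_ratSize (q : ℚ) : 1 ≤ ratSize q := by
  unfold ratSize
  omega

theorem ratSize_neg (q : ℚ) : ratSize (-q) = ratSize q := by
  simp only [ratSize, Rat.neg_num, Int.natAbs_neg, Rat.neg_den]

theorem ratSize_two_pow (n : ℕ) : ratSize (2 ^ n) = n + 3 := by
  simp only [ratSize, Rat.num_pow, Rat.num_ofNat, Int.natAbs_pow, Int.reduceAbs, Nat.size_pow,
    Rat.den_pow, Rat.den_ofNat, one_pow, Nat.size_one]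
  omega

theorem exists_int_eq_mul_of_den_dvd {q : ℚ} {N L : ℕ} (hdvd : q.den ∣ N) (hN : N ≤ 2 ^ L)
    (hq : ratSize q ≤ L) : ∃ z : ℤ, (z : ℚ) = N * q ∧ |z| ≤ 2 ^ (2 * L) := by
  obtain ⟨e, rfl⟩ := hdvd
  refine ⟨e * q.num, ?_, ?_⟩
  · push_cast
    rw [mul_comm (q.den : ℚ), mul_assoc, Rat.den_mul_eq_num]
  · have he : e ≤ 2 ^ L := (Nat.le_mul_of_pos_left e q.den_pos).trans hN
    have hnum : q.num.natAbs ≤ 2 ^ L :=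
      (natAbs_num_le_two_pow_ratSize q).trans (Nat.pow_le_pow_right two_pos hq)
    rw [abs_mul, Nat.abs_cast, Int.abs_eq_natAbs, two_mul, pow_add]
    exact_mod_cast Nat.mul_le_mul he hnum

theorem exists_common_denominator {ι : Type*} [Fintype ι] (q : ι → ℚ) :
    ∃ N : ℕ, 0 < N ∧ ∀ i, ∃ z : ℤ, (z : ℚ) = N * q i ∧ |z| ≤ 2 ^ (2 * ∑ i, ratSize (q i)) := by
  have hprod : ∏ i, (q i).den ≤ 2 ^ ∑ i, ratSize (q i) :=
    (Finset.prod_le_prod' fun i _ => den_le_two_pow_ratSize (q i)).trans_eq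
      (Finset.prod_pow_eq_pow_sum _ _ _)
  refine ⟨∏ i, (q i).den, Finset.prod_pos fun i _ => (q i).den_pos, fun i => ?_⟩
  exact exists_int_eq_mul_of_den_dvd (Finset.dvd_prod_of_mem _ (Finset.mem_univ i)) hprod
    (Finset.single_le_sum (f := fun i => ratSize (q i)) (fun _ _ => Nat.zero_le _)
      (Finset.mem_univ i))

theorem factorial_mul_pow_le_two_pow {m n L : ℕ} (hm : m ≤ L) (hn : n ≤ L) :
    n.factorial * (m * (2 ^ (2 * L)) ^ 2) ^ n ≤ 2 ^ (6 * L ^ 2) :=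
  calc n.factorial * (m * (2 ^ (2 * L)) ^ 2) ^ n
      ≤ n ^ n * (m * (2 ^ (2 * L)) ^ 2) ^ n := Nat.mul_le_mul_right _ (Nat.factorial_le_pow n)
    _ = (n * (m * (2 ^ (2 * L)) ^ 2)) ^ n := (mul_pow _ _ _).symm
    _ ≤ (2 ^ L * (2 ^ L * (2 ^ (2 * L)) ^ 2)) ^ n := by
        have hL : L ≤ 2 ^ L := Nat.lt_two_pow_self.le
        gcongr
        exacts [hn.trans hL, hm.trans hL]
    _ = 2 ^ (6 * L * n) := by
        simp only [← pow_mul, ← pow_add]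
        congr 1
        ring
    _ ≤ 2 ^ (6 * L ^ 2) := by
        rw [sq, ← mul_assoc]
        gcongr
        norm_num

variable {m n : Type*} [Fintype m] [Fintype n]

/-- The total bit length of the coefficients of the rational linear system `A μ = w`. -/
def systemSize (A : Matrix m n ℚ) (w : m → ℚ) : ℕ :=
  ∑ i, ∑ j, ratSize (A i j) + ∑ i, ratSize (w i)

theorem card_le_systemSize (A : Matrix m n ℚ) (w : m → ℚ) : Fintype.card m ≤ systemSize A w :=
  calc Fintype.card m = ∑ _i : m, 1 := Fintype.card_eq_sum_ones
    _ ≤ ∑ i, ratSize (w i) := Finset.sum_le_sum fun i _ => one_le_ratSize (w i)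
    _ ≤ systemSize A w := Nat.le_add_left _ _

theorem exists_integral_multiple_of_system (A : Matrix m n ℚ) (w : m → ℚ) :
    ∃ N : ℕ, 0 < N ∧ ∃ (A' : Matrix m n ℤ) (w' : m → ℤ),
      (∀ i j, (A' i j : ℚ) = N * A i j ∧ |A' i j| ≤ 2 ^ (2 * systemSize A w)) ∧
      ∀ i, (w' i : ℚ) = N * w i ∧ |w' i| ≤ 2 ^ (2 * systemSize A w) := by
  obtain ⟨N, hN, hz⟩ := exists_common_denominator (Sum.elim (fun p : m × n => A p.1 p.2) w)
  simp only [Fintype.sum_sum_type, Fintype.sum_prod_type, Sum.elim_inl, Sum.elim_inr] at hz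
  choose z hz using hz
  exact ⟨N, hN, of fun i j => z (.inl (i, j)), fun i => z (.inr i),
    fun i j => hz (.inl (i, j)), fun i => hz (.inr i)⟩

theorem abs_le_two_pow_of_rat_mulVec_eq {𝕜 : Type*} [Field 𝕜] [LinearOrder 𝕜]
    [IsStrictOrderedRing 𝕜] {A : Matrix m n ℚ}
    (hA : Function.Injective (A.map (Rat.cast : ℚ → 𝕜)).mulVec) {w : m → ℚ} {μ : n → 𝕜}
    (h : A.map (Rat.cast : ℚ → 𝕜) *ᵥ μ = fun i => (w i : 𝕜)) (j : n) :
    |μ j| ≤ 2 ^ (6 * systemSize A w ^ 2) := by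
  obtain ⟨N, hN, A', w', hA', hw'⟩ := exists_integral_multiple_of_system A w
  have hN' : (N : 𝕜) ≠ 0 := by exact_mod_cast hN.ne'
  have hscaleA : A'.map (Int.cast : ℤ → 𝕜) = (N : 𝕜) • A.map (Rat.cast : ℚ → 𝕜) := by
    ext i k
    simpa using congrArg (Rat.cast : ℚ → 𝕜) (hA' i k).1
  have hscalew : ∀ i, (w' i : 𝕜) = N * w i := fun i => by
    simpa using congrArg (Rat.cast : ℚ → 𝕜) (hw' i).1
  have hinj : Function.Injective (A'.map (Int.cast : ℤ → 𝕜)).mulVec := fun u v huv => by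
    simp only [hscaleA, smul_mulVec] at huv
    exact hA (smul_right_injective _ hN' huv)
  have hsystem : A'.map (Int.cast : ℤ → 𝕜) *ᵥ μ = fun i => (w' i : 𝕜) := by
    ext i
    rw [hscaleA, smul_mulVec, h, hscalew, Pi.smul_apply, smul_eq_mul]
  have hcard : Fintype.card n ≤ Fintype.card m :=
    card_le_of_injective 𝕜 (mulVecLin (A.map (Rat.cast : ℚ → 𝕜))) hA
  have hm := card_le_systemSize A w
  refine (abs_le_of_int_mulVec_eq_of_injective hinj hsystem (fun i k => (hA' i k).2)
    (fun i => (hw' i).2) j).trans ?_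
  exact_mod_cast factorial_mul_pow_le_two_pow hm (hcard.trans hm)

theorem systemSize_submatrix_le {p : Type*} [Fintype p] (A : Matrix m n ℚ) (w : m → ℚ) {e : p → n}
    (he : Function.Injective e) : systemSize (A.submatrix id e) w ≤ systemSize A w := by
  refine Nat.add_le_add_right (Finset.sum_le_sum fun i _ => ?_) _
  exact Finset.sum_map Finset.univ ⟨e, he⟩ (fun j => ratSize (A i j)) ▸
    Finset.sum_le_sum_of_subset (Finset.subset_univ _)

theorem IsBasicDualSolution.le_two_pow {𝕜 : Type*} [Field 𝕜] [LinearOrder 𝕜]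
    [IsStrictOrderedRing 𝕜] {A : Matrix m n ℚ} {d : n → ℚ} {t : Finset m} {μ : m → 𝕜}
    (h : IsBasicDualSolution (A.map (Rat.cast : ℚ → 𝕜)) (fun j => (d j : 𝕜)) t μ) {i : m}
    (hi : i ∈ t) : μ i ≤ 2 ^ (6 * systemSize Aᵀ d ^ 2) := by
  let A' : Matrix n t ℚ := Aᵀ.submatrix id Subtype.val
  have hinj : Function.Injective (A'.map (Rat.cast : ℚ → 𝕜)).mulVec :=
    mulVec_injective_iff.2 h.linearIndepOn
  have hsystem : A'.map (Rat.cast : ℚ → 𝕜) *ᵥ (fun i : t => μ i) = fun j => (d j : 𝕜) := by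
    ext j
    refine Eq.trans ?_ (congrFun h.sum_smul_eq j)
    rw [Finset.sum_apply, ← Finset.sum_coe_sort]
    exact Finset.sum_congr rfl fun i _ => mul_comm _ _
  calc μ i ≤ |μ i| := le_abs_self _
    _ ≤ 2 ^ (6 * systemSize A' d ^ 2) := abs_le_two_pow_of_rat_mulVec_eq hinj hsystem ⟨i, hi⟩
    _ ≤ 2 ^ (6 * systemSize Aᵀ d ^ 2) := by
        gcongr
        exacts [one_le_two, systemSize_submatrix_le _ _ Subtype.val_injective]

theorem le_dotProduct_add_two_pow_mul_violation {𝕜 : Type*} [Field 𝕜] [LinearOrder 𝕜]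
    [IsStrictOrderedRing 𝕜] (A : Matrix m n ℚ) (d : n → ℚ) {r : m → 𝕜} {β : 𝕜} {y₀ : n → 𝕜}
    (hy₀ : r ≤ A.map (Rat.cast : ℚ → 𝕜) *ᵥ y₀)
    (hβ : ∀ y, r ≤ A.map (Rat.cast : ℚ → 𝕜) *ᵥ y → β ≤ (fun j => (d j : 𝕜)) ⬝ᵥ y)
    {o : m} {z : n → 𝕜} (hz : ∀ i ≠ o, r i ≤ (A.map (Rat.cast : ℚ → 𝕜) *ᵥ z) i)
    (hzo : (A.map (Rat.cast : ℚ → 𝕜) *ᵥ z) o ≤ r o) :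
    β ≤ (fun j => (d j : 𝕜)) ⬝ᵥ z + 2 ^ (6 * systemSize Aᵀ d ^ 2) *
      (r o - (A.map (Rat.cast : ℚ → 𝕜) *ᵥ z) o) := by
  classical
  let e := dotProductEquiv 𝕜 n
  exact le_add_mul_violation (φ := fun i => e (A.map (Rat.cast : ℚ → 𝕜) i))
    (d := e fun j => (d j : 𝕜)) (by positivity)
    (fun t μ h => (h.of_map (f := e.toLinearMap) e.injective).le_two_pow) hy₀ hβ hz hzo

end RationalSystems

theorem globalOptimizers_eq_of_exact_penalty {α : Type*} {K : Set α} {F H : α → EReal}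
    (hle : ∀ p ∈ K, H p ≤ F p) (hex : ∀ p ∈ K, F p = H p ∨ ∃ q ∈ K, F q < H p) :
    globalOptimizers K F = globalOptimizers K H := by
  ext p
  simp only [globalOptimizers, Set.mem_ofPred_eq, isMinOn_iff]
  refine and_congr_right fun hp => ⟨fun ⟨hfin, hmin⟩ => ⟨(hle p hp).trans_lt hfin, fun q hq => ?_⟩,
    fun ⟨hfin, hmin⟩ => ?_⟩
  · refine (hle p hp).trans ?_
    rcases hex q hq with heq | ⟨q', hq', hlt⟩
    · exact heq ▸ hmin q hq
    · exact (hmin q' hq').trans hlt.le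
  · rcases hex p hp with heq | ⟨q, hq, hlt⟩
    · exact ⟨heq ▸ hfin, fun q hq => heq ▸ (hmin q hq).trans (hle q hq)⟩
    · exact absurd ((hmin q hq).trans (hle q hq)) hlt.not_ge

namespace BilevelData

variable {nx ny k l : ℕ}

/-- The coefficient matrix of the system `-fᵀ y ≥ -v`, `D y ≥ b - C x` that describes `S(x)` when
`v` is the optimal value of the follower; the row of `-f` has index `none`. -/
def optMatrix (P : BilevelData nx ny k l) : Matrix (Option (Fin l)) (Fin ny) ℚ :=
  of fun
    | none => -P.f
    | some i => P.D i

/-- The right-hand side of the system with coefficient matrix `optMatrix`. -/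
def optRhs (P : BilevelData nx ny k l) (x : Fin nx → ℝ) (v : ℝ) : Option (Fin l) → ℝ
  | none => -v
  | some i => (realVec P.b - realMat P.C *ᵥ x) i

theorem systemSize_optMatrix_le (P : BilevelData nx ny k l) :
    systemSize P.optMatrixᵀ P.d ≤ P.encodingLength := by
  have hD : ∑ j, ∑ i, ratSize (P.D i j) ≤ matSize P.D :=
    Finset.sum_comm.trans_le (Nat.le_add_left _ _)
  have hrow : systemSize P.optMatrixᵀ P.d =
      ∑ j, ratSize (P.f j) + ∑ j, ∑ i, ratSize (P.D i j) + ∑ j, ratSize (P.d j) := by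
    simp [systemSize, optMatrix, Fintype.sum_option, Finset.sum_add_distrib, ratSize_neg]
  rw [hrow]
  unfold encodingLength vecSize
  omega

theorem optMatrix_mulVec_none (P : BilevelData nx ny k l) (y : Fin ny → ℝ) :
    (P.optMatrix.map (Rat.cast : ℚ → ℝ) *ᵥ y) none = -(realVec P.f ⬝ᵥ y) := by
  simp [optMatrix, mulVec, dotProduct, realVec]

theorem optMatrix_mulVec_some (P : BilevelData nx ny k l) (y : Fin ny → ℝ) (i : Fin l) :
    (P.optMatrix.map (Rat.cast : ℚ → ℝ) *ᵥ y) (some i) = (realMat P.D *ᵥ y) i :=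
  rfl

theorem mem_followerFeasible_iff (P : BilevelData nx ny k l) {x : Fin nx → ℝ} {y : Fin ny → ℝ} :
    y ∈ P.followerFeasible x ↔ realVec P.b - realMat P.C *ᵥ x ≤ realMat P.D *ᵥ y :=
  (sub_le_iff_le_add' (a := realVec P.b)).symm

theorem mem_auxLeaderSet_iff (P : BilevelData nx ny k l) {p : (Fin nx → ℝ) × (Fin ny → ℝ)} :
    p ∈ P.auxLeaderSet ↔ p.1 ∈ P.leaderSet ∧ p.2 ∈ P.followerFeasible p.1 :=
  and_congr_right fun _ => P.mem_followerFeasible_iff.symm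

theorem mem_followerOpt_iff_le (P : BilevelData nx ny k l) {x : Fin nx → ℝ} {y₀ y : Fin ny → ℝ}
    (hy₀ : y₀ ∈ P.followerOpt x) :
    y ∈ P.followerOpt x ↔ y ∈ P.followerFeasible x ∧ realVec P.f ⬝ᵥ y ≤ realVec P.f ⬝ᵥ y₀ :=
  and_congr_right fun _ => isMinOn_iff.trans
    ⟨fun hmin => hmin y₀ hy₀.1, fun hle z hz => hle.trans (isMinOn_iff.1 hy₀.2 z hz)⟩

theorem mem_followerOpt_iff_optRhs_le (P : BilevelData nx ny k l) {x : Fin nx → ℝ}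
    {y₀ y : Fin ny → ℝ} (hy₀ : y₀ ∈ P.followerOpt x) :
    y ∈ P.followerOpt x ↔
      P.optRhs x (realVec P.f ⬝ᵥ y₀) ≤ P.optMatrix.map (Rat.cast : ℚ → ℝ) *ᵥ y := by
  rw [P.mem_followerOpt_iff_le hy₀, mem_followerFeasible_iff, and_comm]
  simp only [Pi.le_def, Option.forall, optMatrix_mulVec_none, optMatrix_mulVec_some, optRhs,
    neg_le_neg_iff]

theorem exists_mem_followerOpt_lt (P : BilevelData nx ny k l) {x : Fin nx → ℝ}
    {y₀ ybar : Fin ny → ℝ} (hy₀ : y₀ ∈ P.followerOpt x) (hybar : ybar ∈ P.followerFeasible x)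
    (hgap : realVec P.f ⬝ᵥ y₀ < realVec P.f ⬝ᵥ ybar) {κ : ℝ}
    (hκ : 2 ^ (6 * P.encodingLength ^ 2) < κ) :
    ∃ y ∈ P.followerOpt x, realVec P.d ⬝ᵥ y <
      realVec P.d ⬝ᵥ ybar + κ * (realVec P.f ⬝ᵥ ybar - realVec P.f ⬝ᵥ y₀) := by
  by_contra! hlower
  have hκ' : (2 : ℝ) ^ (6 * systemSize P.optMatrixᵀ P.d ^ 2) < κ := by
    refine lt_of_le_of_lt ?_ hκ
    gcongr
    exacts [one_le_two, P.systemSize_optMatrix_le]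
  have hbound := le_dotProduct_add_two_pow_mul_violation P.optMatrix P.d (o := none)
    ((P.mem_followerOpt_iff_optRhs_le hy₀).1 hy₀)
    (fun y hy => hlower y ((P.mem_followerOpt_iff_optRhs_le hy₀).2 hy)) (z := ybar)
    (Option.forall.2 ⟨fun h => absurd rfl h, fun i _ => P.mem_followerFeasible_iff.1 hybar i⟩)
    (by simpa [optMatrix_mulVec_none, optRhs] using hgap.le)
  rw [optMatrix_mulVec_none, optRhs, neg_sub_neg] at hbound
  exact hbound.not_gt (add_lt_add_right (mul_lt_mul_of_pos_right hκ' (sub_pos.2 hgap)) _)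

theorem auxFollowerOpt_eq_image (P : BilevelData nx ny k l) {x : Fin nx → ℝ} {ybar : Fin ny → ℝ}
    (hybar : ybar ∈ P.followerFeasible x) :
    P.auxFollowerOpt (x, ybar) =
      (fun y => (y, realVec P.f ⬝ᵥ ybar - realVec P.f ⬝ᵥ y)) '' P.followerOpt x := by
  ext ⟨y, ε⟩
  simp only [Set.mem_image, Prod.mk.injEq]
  constructor
  · rintro ⟨⟨hy, hε, hε₀⟩, hmin⟩
    refine ⟨y, ⟨hy, isMinOn_iff.2 fun y' hy' => ?_⟩, rfl, hε⟩
    -- A feasible `y'` that is worse than `ȳ` violates `ε ≥ 0`, but then it is worse than `y` too.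
    rcases le_total (realVec P.f ⬝ᵥ y') (realVec P.f ⬝ᵥ ybar) with hle | hle
    · exact isMinOn_iff.1 hmin (y', _) ⟨hy', rfl, sub_nonneg.2 hle⟩
    · exact (sub_nonneg.1 (hε.symm ▸ hε₀)).trans hle
  · rintro ⟨y, hy, rfl, rfl⟩
    exact ⟨⟨hy.1, rfl, sub_nonneg.2 (isMinOn_iff.1 hy.2 ybar hybar)⟩,
      isMinOn_iff.2 fun z hz => isMinOn_iff.1 hy.2 z.1 hz.1⟩

theorem penalizedObj_le_coupledObj (P : BilevelData nx ny k l) (κ : ℝ)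
    (p : (Fin nx → ℝ) × (Fin ny → ℝ)) : P.penalizedObj κ p ≤ P.coupledObj p := by
  refine add_le_add_right (le_iInf₂ fun z hz => (iInf₂_le z hz.2).trans ?_) _
  rw [hz.1, mul_zero, EReal.coe_zero]

theorem penalizedObj_eq_top (P : BilevelData nx ny k l) (κ : ℝ) {x : Fin nx → ℝ}
    {ybar : Fin ny → ℝ} (hybar : ybar ∈ P.followerFeasible x) (hx : P.followerOpt x = ∅) :
    P.penalizedObj κ (x, ybar) = ⊤ := by
  rw [penalizedObj, P.auxFollowerOpt_eq_image hybar, hx, Set.image_empty, iInf_emptyset,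
    EReal.coe_add_top]

theorem penalizedObj_eq_of_mem_followerOpt (P : BilevelData nx ny k l) (κ : ℝ) {x : Fin nx → ℝ}
    {y₀ ybar : Fin ny → ℝ} (hy₀ : y₀ ∈ P.followerOpt x) (hybar : ybar ∈ P.followerFeasible x) :
    P.penalizedObj κ (x, ybar) = ((realVec P.c ⬝ᵥ x + (realVec P.d ⬝ᵥ ybar +
      κ * (realVec P.f ⬝ᵥ ybar - realVec P.f ⬝ᵥ y₀)) : ℝ) : EReal) := by
  have hval : ∀ y ∈ P.followerOpt x, realVec P.f ⬝ᵥ y = realVec P.f ⬝ᵥ y₀ := fun y hy =>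
    (isMinOn_iff.1 hy.2 y₀ hy₀.1).antisymm (isMinOn_iff.1 hy₀.2 y hy.1)
  have hinf : ⨅ y ∈ P.followerOpt x,
      ((κ * (realVec P.f ⬝ᵥ ybar - realVec P.f ⬝ᵥ y) : ℝ) : EReal) =
        (κ * (realVec P.f ⬝ᵥ ybar - realVec P.f ⬝ᵥ y₀) : ℝ) := by
    rw [biInf_congr fun y hy => by rw [hval y hy], biInf_const ⟨y₀, hy₀⟩]
  rw [penalizedObj, P.auxFollowerOpt_eq_image hybar, iInf_image, hinf, ← EReal.coe_add, add_assoc]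

theorem coupledObj_eq_of_mem_followerOpt (P : BilevelData nx ny k l) {x : Fin nx → ℝ}
    {y : Fin ny → ℝ} (hy : y ∈ P.followerOpt x) :
    P.coupledObj (x, y) = ((realVec P.c ⬝ᵥ x + realVec P.d ⬝ᵥ y : ℝ) : EReal) := by
  have hmem : ((y, 0) : (Fin ny → ℝ) × ℝ) ∈ P.auxFollowerOpt (x, y) := by
    rw [P.auxFollowerOpt_eq_image hy.1]
    exact ⟨y, hy, Prod.ext rfl (sub_self _)⟩
  have hne : {z | z.2 = 0 ∧ z ∈ P.auxFollowerOpt (x, y)}.Nonempty := ⟨(y, 0), rfl, hmem⟩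
  rw [coupledObj, biInf_const hne, add_zero]

theorem coupledObj_eq_penalizedObj_or_exists_lt (P : BilevelData nx ny k l) {κ : ℝ}
    (hκ : 2 ^ (6 * P.encodingLength ^ 2) < κ) {p : (Fin nx → ℝ) × (Fin ny → ℝ)}
    (hp : p ∈ P.auxLeaderSet) :
    P.coupledObj p = P.penalizedObj κ p ∨
      ∃ q ∈ P.auxLeaderSet, P.coupledObj q < P.penalizedObj κ p := by
  obtain ⟨x, ybar⟩ := p
  obtain ⟨hx, hybar⟩ := P.mem_auxLeaderSet_iff.1 hp
  rcases (P.followerOpt x).eq_empty_or_nonempty with hempty | ⟨y₀, hy₀⟩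
  · have htop := P.penalizedObj_eq_top κ hybar hempty
    exact .inl ((top_unique (htop ▸ P.penalizedObj_le_coupledObj κ _)).trans htop.symm)
  rw [P.penalizedObj_eq_of_mem_followerOpt κ hy₀ hybar]
  rcases (isMinOn_iff.1 hy₀.2 ybar hybar).eq_or_lt with hgap | hgap
  · have hopt : ybar ∈ P.followerOpt x := (P.mem_followerOpt_iff_le hy₀).2 ⟨hybar, hgap.ge⟩
    left
    rw [P.coupledObj_eq_of_mem_followerOpt hopt, hgap, sub_self, mul_zero, add_zero]
  · obtain ⟨y, hy, hlt⟩ := P.exists_mem_followerOpt_lt hy₀ hybar hgap hκ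
    refine .inr ⟨(x, y), P.mem_auxLeaderSet_iff.2 ⟨hx, hy.1⟩, ?_⟩
    rw [P.coupledObj_eq_of_mem_followerOpt hy, EReal.coe_lt_coe_iff]
    exact add_lt_add_right hlt _

theorem globalOptimizers_coupledObj_eq_penalizedObj (P : BilevelData nx ny k l) {κ : ℝ}
    (hκ : 2 ^ (6 * P.encodingLength ^ 2) < κ) :
    globalOptimizers P.auxLeaderSet P.coupledObj =
      globalOptimizers P.auxLeaderSet (P.penalizedObj κ) :=
  globalOptimizers_eq_of_exact_penalty (fun p _ => P.penalizedObj_le_coupledObj κ p) fun _ hp =>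
    P.coupledObj_eq_penalizedObj_or_exists_lt hκ hp

end BilevelData

theorem mainTheorem3_general :
    ∃ q : Polynomial ℕ, ∀ (nx ny k l : ℕ) (P : BilevelData nx ny k l),
      ∃ κ : ℚ, 0 < κ ∧ ratSize κ ≤ q.eval P.encodingLength ∧
        globalOptimizers P.auxLeaderSet P.coupledObj =
          globalOptimizers P.auxLeaderSet (P.penalizedObj (κ : ℝ)) := by
  refine ⟨6 * Polynomial.X ^ 2 + 4, fun nx ny k l P => ?_⟩
  refine ⟨2 ^ (6 * P.encodingLength ^ 2 + 1), by positivity, ?_,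
    P.globalOptimizers_coupledObj_eq_penalizedObj ?_⟩
  · simp [ratSize_two_pow]
  · rw [Rat.cast_pow, Rat.cast_ofNat]
    exact pow_lt_pow_right₀ one_lt_two (Nat.lt_succ_self _)

theorem mainTheorem3 :
    ∃ q : Polynomial ℕ, ∀ (nx ny k l : ℕ) (P : BilevelData nx ny k l),
      P.StandingAssumptions →
        ∃ κ : ℚ, 0 < κ ∧ ratSize κ ≤ q.eval P.encodingLength ∧
          globalOptimizers P.auxLeaderSet P.coupledObj =
            globalOptimizers P.auxLeaderSet (P.penalizedObj (κ : ℝ)) := by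
  obtain ⟨q, hq⟩ := mainTheorem3_general
  exact ⟨q, fun nx ny k l P _ => hq nx ny k l P⟩
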